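/- Let $\mathbb{K}=\mathbb{R}$ or $\mathbb{C}$, and let $q\in\mathbb{K}$ be nonzero and not a root of unity (in particular $q\neq 1$). On the field of fractions $\mathcal{F}$ of the ring $\mathbb{K}[[x,t_1,t_2,\dots]]$ put $$(Df)(x,t)=f(qx,t),\qquad (D_qf)(x,t)=\frac{f(qx,t)-f(x,t)}{(q-1)x},\qquad \partial_k=\frac{\partial}{\partial t_k}.$$ Formal pseudo-$q$-difference operators $\sum_{n\le N}a_nD_q^n$ ($a_n\in\mathcal{F}$) form a ring under $$D_q^n\circ f=\sum_{k\ge 0}\begin{bmatrix}n\\k\end{bmatrix}_q D^{n-k}(D_q^kf)\,D_q^{n-k}\quad(n\in\mathbb{Z}),\qquad \begin{bmatrix}n\\k\end{bmatrix}_q=\prod_{i=0}^{k-1}\frac{[n-i]_q}{[i+1]_q},\quad [m]_q=\frac{q^m-1}{q-1}.$$ Let $p_n(y)=\sum_{k_1+2k_2+\cdots+nk_n=n}\frac{y_1^{k_1}}{k_1!}\cdots\frac{y_n^{k_n}}{k_n!}$ be the elementary Schur polynomials and $\tilde\partial=(\partial_1,\partial_2/2,\partial_3/3,\dots)$. **Theorem.**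 Let $\tau(t_1,t_2,\dots)$ be a nonzero formal power series over $\mathbb{K}$ (for instance a tau function of the KP hierarchy), and let $$\tau_q(x,t)=\tau\bigl(t+[x]_q\bigr),\qquad [x]_q=\left(\frac{(1-q)^kx^k}{k(1-q^k)}\right)_{k\ge 1},\qquad S=\sum_{j\ge 0}\frac{p_j(-\tilde\partial)\tau_q}{\tau_q}\,D_q^{-j}.$$ Then $\tau_q\ne 0$, $S$ is invertible, the operator $L=SD_qS^{-1}$ of the qKP hierarchy has the form $L=D_q+a_0+a_1D_q^{-1}+a_2D_q^{-2}+\cdots$, and $u=a_1$ is given by $$u=(1-D)\left(\frac{\frac12(\partial_1^2-\partial_2)\tau_q}{\tau_q}\right)-\left(\frac{\partial_1\tau_q}{\tau_q}\right)^2+\frac{\partial_1\tau_q}{\tau_q}\,D\left(\frac{\partial_1\tau_q}{\tau_q}\right)+D_q\left(\frac{\partial_1\tau_q}{\tau_q}\right),$$ equivalently by $$u=-(q-1)x\,D_q\left(\frac{p_2(-\tilde\partial)\tau_q}{\tau_q}\right)+\frac{\partial_1\tau_q}{\tau_q}\,(q-1)x\,D_q\left(\frac{\partial_1\tau_q}{\tau_q}\right)+D_q\left(\frac{\partial_1\tau_q}{\tau_q}\right).$$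 Moreover, as $q\to 1$ in $\mathbb{K}$ through nonzero values that are not roots of unity, $u$ converges to $$\partial_1\left(\frac{\partial_1\tau}{\tau}\right)(t_1+x,t_2,t_3,\dots)=(\partial_1^2\log\tau)(t_1+x,t_2,t_3,\dots).$$ Here $f_q\to f$ in $\mathcal{F}$ means that there are power series with $f_q=A_q/B_q$ for $q$ near $1$, $f=A/B$, $B\neq0$, such that $A_q\to A$ and $B_q\to B$ coefficientwise. -/

import Mathlib

open Filter Topology

noncomputable section

namespace QKP

open Finset.HasAntidiagonal (antidiagonal)

/-- Admissible values of `q` in `𝕜`: `q ≠ 0` and `q` is not a root of unity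
(in particular `q ≠ 1`). -/
def QParam (𝕜 : Type*) [Field 𝕜] : Type _ :=
  {q : 𝕜 // q ≠ 0 ∧ ∀ n : ℕ, 0 < n → q ^ n ≠ 1}

/-- The underlying scalar of an admissible `q`. -/
def QParam.val {𝕜 : Type*} [Field 𝕜] (q : QParam 𝕜) : 𝕜 := Subtype.val q

/-! ### Functions of `x, t₁, t₂, …` -/

/-- The variables: `none` is `x`, and `some k` is `t_k` for `k = 1, 2, …`. -/
abbrev Var : Type := Option ℕ+

/-- Formal power series in `x, t₁, t₂, …`. -/
abbrev Ser (𝕜 : Type*) [Field 𝕜] : Type _ := MvPowerSeries Var 𝕜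

/-- The field of fractions of the ring of formal power series in `x, t₁, t₂, …`. -/
abbrev Fun (𝕜 : Type*) [Field 𝕜] : Type _ := FractionRing (Ser 𝕜)

variable {𝕜 : Type*} [Field 𝕜]

/-- A power series regarded as an element of the field of fractions. -/
abbrev toFun (f : Ser 𝕜) : Fun 𝕜 := algebraMap (Ser 𝕜) (Fun 𝕜) f

/-- The variable `x` as an element of the field of fractions. -/
def xvar : Fun 𝕜 := toFun (MvPowerSeries.X none)

/-- The scaling vector of the substitution `x ↦ a x`, `t_k ↦ t_k`. -/
def scaleVec (a : 𝕜) : Var → 𝕜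
  | none => a
  | some _ => 1

theorem scaleVec_mul_inv (a : 𝕜) (ha : a ≠ 0) : scaleVec a * scaleVec a⁻¹ = 1 := by
  funext v
  cases v <;> simp [scaleVec, ha]

/-- The substitution `f(x,t) ↦ f(ax,t)` on power series, for `a ≠ 0`. -/
def scaleSer (a : 𝕜) (ha : a ≠ 0) : Ser 𝕜 ≃ₐ[𝕜] Ser 𝕜 :=
  AlgEquiv.ofAlgHom (MvPowerSeries.rescaleAlgHom (scaleVec a))
    (MvPowerSeries.rescaleAlgHom (scaleVec a⁻¹))
    (by rw [← MvPowerSeries.rescaleAlgHom_mul, mul_comm, scaleVec_mul_inv a ha,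
          MvPowerSeries.rescaleAlgHom_one])
    (by rw [← MvPowerSeries.rescaleAlgHom_mul, scaleVec_mul_inv a ha,
          MvPowerSeries.rescaleAlgHom_one])

/-- The automorphism `D`, `(D f)(x,t) = f(qx,t)`, on the field of fractions. -/
def D (q : QParam 𝕜) : Fun 𝕜 ≃ₐ[𝕜] Fun 𝕜 :=
  IsFractionRing.algEquivOfAlgEquiv (scaleSer q.val q.2.1)

/-- The `q`-derivative `D_q f = (f(qx,t) - f(x,t)) / ((q-1)x)`. -/
def Dq (q : QParam 𝕜) (f : Fun 𝕜) : Fun 𝕜 := (D q f - f) / ((q.val - 1) • xvar)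

/-! ### Pseudo-`q`-difference operators -/

/-- The `q`-number `[n]_q = (q^n - 1)/(q - 1)`. -/
def qNum (q : QParam 𝕜) (n : ℤ) : 𝕜 := (q.val ^ n - 1) / (q.val - 1)

/-- The Gaussian binomial coefficient
`[n]_q [n-1]_q ⋯ [n-k+1]_q / ([1]_q [2]_q ⋯ [k]_q)` for `n ∈ ℤ`, `k ∈ ℕ`. -/
def qBinom (q : QParam 𝕜) (n : ℤ) (k : ℕ) : 𝕜 :=
  ∏ i ∈ Finset.range k, qNum q (n - i) / qNum q (i + 1)

/-- The coefficient of `D_q^(n-k)` in `D_q^n ∘ f`, namely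
`[n choose k]_q D^(n-k)(D_q^k f)`, so that `D_q^n ∘ f = ∑_{k ≥ 0} comm q n k f · D_q^(n-k)`. -/
def comm (q : QParam 𝕜) (n : ℤ) (k : ℕ) (f : Fun 𝕜) : Fun 𝕜 :=
  qBinom q n k • (D q ^ (n - k)) ((Dq q)^[k] f)

/-- A formal pseudo-`q`-difference operator `∑_{n ≤ N} a_n D_q^n`. -/
@[ext] structure PDO (q : QParam 𝕜) where
  /-- `coeff n` is the coefficient of `D_q^n`. -/
  coeff : ℤ → Fun 𝕜
  bdd : ∃ N : ℤ, ∀ n, N < n → coeff n = 0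

theorem D_toFun (q : QParam 𝕜) (f : Ser 𝕜) :
    D q (toFun f) = toFun (MvPowerSeries.rescale (scaleVec q.val) f) := by
  simp [D, toFun, scaleSer, MvPowerSeries.rescaleAlgHom_apply]

theorem D_xvar (q : QParam 𝕜) : D q xvar = q.val • (xvar : Fun 𝕜) := by
  have h : MvPowerSeries.rescale (scaleVec q.val) (MvPowerSeries.X none : Ser 𝕜)
      = q.val • (MvPowerSeries.X none : Ser 𝕜) := by
    classical
    ext n
    rw [MvPowerSeries.coeff_rescale, map_smul, MvPowerSeries.coeff_X, smul_eq_mul]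
    split_ifs with hn
    · subst hn; simp [scaleVec]
    · simp
  rw [xvar, D_toFun, h]
  exact Algebra.smul_def q.val (MvPowerSeries.X none : Ser 𝕜) ▸ by
    rw [toFun, map_mul, ← IsScalarTower.algebraMap_apply, Algebra.smul_def]

theorem xvar_ne_zero : (xvar : Fun 𝕜) ≠ 0 := by
  intro h
  have h0 : (MvPowerSeries.X none : Ser 𝕜) = 0 :=
    IsFractionRing.injective (Ser 𝕜) (Fun 𝕜) (by rw [map_zero]; exact h)
  have := congrArg (MvPowerSeries.coeff (Finsupp.single none 1)) h0
  simp [MvPowerSeries.X] at this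

theorem q_ne_one (q : QParam 𝕜) : q.val - 1 ≠ 0 := by
  have := q.2.2 1 one_pos
  simpa [QParam.val, sub_eq_zero] using this

theorem qNum_ne (q : QParam 𝕜) (n : ℕ) : qNum q (n + 1) ≠ 0 := by
  refine div_ne_zero ?_ (q_ne_one q)
  have := q.2.2 (n + 1) n.succ_pos
  rw [sub_ne_zero]
  exact_mod_cast this

theorem qBinom_zero (q : QParam 𝕜) (n : ℤ) : qBinom q n 0 = 1 := by simp [qBinom]

theorem qBinom_pascal (q : QParam 𝕜) (n : ℤ) (k : ℕ) :
    qBinom q (n + 1) (k + 1) = qBinom q n (k + 1) + q.val ^ (n - k) * qBinom q n k := by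
  have h1 : qBinom q n (k + 1) = qBinom q n k * (qNum q (n - k) / qNum q (k + 1)) := by
    rw [qBinom, Finset.prod_range_succ, ← qBinom]
  have h2 : qBinom q (n + 1) (k + 1) = qBinom q n k * (qNum q (n + 1) / qNum q (k + 1)) := by
    simp only [qBinom, Finset.prod_div_distrib]
    rw [Finset.prod_range_succ' (fun i : ℕ => qNum q (n + 1 - i)),
      Finset.prod_range_succ (fun i : ℕ => qNum q ((i : ℤ) + 1))]
    have : ∀ i : ℕ, n + 1 - ((i + 1 : ℕ) : ℤ) = n - i := fun i => by push_cast; ring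
    simp only [this]
    have : n + 1 - ((0 : ℕ) : ℤ) = n + 1 := by simp
    rw [this, div_mul_div_comm]
  have h3 : qNum q (n + 1) = qNum q (n - k) + q.val ^ (n - k) * qNum q (k + 1) := by
    have hq : q.val ≠ 0 := q.2.1
    have : q.val ^ (n + 1) = q.val ^ (n - k) * q.val ^ ((k : ℤ) + 1) := by
      rw [← zpow_add₀ hq]; congr 1; ring
    simp only [qNum, this]
    have := q_ne_one q
    field_simp
    ring
  have h4 := qNum_ne q k
  rw [h1, h2, h3]
  field_simp

theorem Dq_add (q : QParam 𝕜) (f g : Fun 𝕜) : Dq q (f + g) = Dq q f + Dq q g := by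
  simp only [Dq, map_add]; ring

theorem Dq_smul (q : QParam 𝕜) (c : 𝕜) (f : Fun 𝕜) : Dq q (c • f) = c • Dq q f := by
  simp only [Dq, map_smul, ← smul_sub, smul_div_assoc]

theorem Dq_mul (q : QParam 𝕜) (f g : Fun 𝕜) :
    Dq q (f * g) = D q f * Dq q g + Dq q f * g := by
  simp only [Dq, map_mul]; ring

theorem Dq_D (q : QParam 𝕜) (f : Fun 𝕜) : Dq q (D q f) = q.val • D q (Dq q f) := by
  have hq : q.val ≠ 0 := q.2.1
  have h1 : algebraMap 𝕜 (Fun 𝕜) q.val ≠ 0 := by simpa using hq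
  have h2 : algebraMap 𝕜 (Fun 𝕜) (q.val - 1) ≠ 0 :=
    (map_ne_zero _).2 (q_ne_one q)
  have h3 := xvar_ne_zero (𝕜 := 𝕜)
  simp only [Dq, map_div₀, map_sub, map_smul, D_xvar]
  simp only [Algebra.smul_def] at *
  field_simp

theorem Dq_D_zpow (q : QParam 𝕜) (n : ℤ) (f : Fun 𝕜) :
    Dq q ((D q ^ n) f) = q.val ^ n • (D q ^ n) (Dq q f) := by
  have hq : q.val ≠ 0 := q.2.1
  induction n generalizing f with
  | zero => simp
  | succ n ih => 
    rw [zpow_add_one, AlgEquiv.mul_apply, ih, Dq_D, map_smul, smul_smul, zpow_add_one₀ hq]; rfl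
  | pred n ih => 
    have h2 := Dq_D q ((D q)⁻¹ f)
    have h3 : D q ((D q)⁻¹ f) = f := by rw [← AlgEquiv.mul_apply]; simp
    rw [h3] at h2
    have h4 : (D q)⁻¹ (Dq q f) = q.val • Dq q ((D q)⁻¹ f) := by
      rw [h2, map_smul, ← AlgEquiv.mul_apply]; simp
    rw [zpow_sub_one, AlgEquiv.mul_apply, AlgEquiv.mul_apply, ih, h4, map_smul, smul_smul,
      zpow_sub_one₀ hq, mul_assoc, inv_mul_cancel₀ hq, mul_one]

theorem comm_zero_right (q : QParam 𝕜) (n : ℤ) (f : Fun 𝕜) : comm q n 0 f = (D q ^ n) f := by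
  simp [comm, qBinom_zero]

theorem comm_succ_zero (q : QParam 𝕜) (n : ℤ) (f : Fun 𝕜) :
    comm q (n + 1) 0 f = D q (comm q n 0 f) := by
  rw [comm_zero_right, comm_zero_right, add_comm, zpow_add, zpow_one]; rfl

theorem comm_succ_succ (q : QParam 𝕜) (n : ℤ) (k : ℕ) (f : Fun 𝕜) :
    comm q (n + 1) (k + 1) f = D q (comm q n (k + 1) f) + Dq q (comm q n k f) := by
  simp only [comm, qBinom_pascal, map_smul, Dq_smul, Dq_D_zpow, Function.iterate_succ_apply']
  rw [← AlgEquiv.mul_apply, ← zpow_one_add]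
  have h1 : n + 1 - ((k + 1 : ℕ) : ℤ) = n - k := by push_cast; ring
  have h2 : 1 + (n - ((k + 1 : ℕ) : ℤ)) = n - k := by push_cast; ring
  rw [h1, h2, add_smul, smul_smul, mul_comm]

theorem comm_add (q : QParam 𝕜) (n : ℤ) (k : ℕ) (f g : Fun 𝕜) :
    comm q n k (f + g) = comm q n k f + comm q n k g := by
  have h : (Dq q)^[k] (f + g) = (Dq q)^[k] f + (Dq q)^[k] g := by
    induction k generalizing f g with
    | zero => rfl
    | succ k ih => simp only [Function.iterate_succ_apply, Dq_add, ih]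
  simp only [comm, h, map_add, smul_add]

/-- `comm q n k` as an additive map. -/
def commHom (q : QParam 𝕜) (n : ℤ) (k : ℕ) : Fun 𝕜 →+ Fun 𝕜 :=
  AddMonoidHom.mk' (comm q n k) (comm_add q n k)

theorem commHom_apply (q : QParam 𝕜) (n : ℤ) (k : ℕ) (f : Fun 𝕜) :
    commHom q n k f = comm q n k f := rfl

theorem comm_zero (q : QParam 𝕜) (n : ℤ) (k : ℕ) : comm q n k 0 = 0 :=
  (commHom q n k).map_zero

theorem comm_sum (q : QParam 𝕜) (n : ℤ) (k : ℕ) {ι : Type*} (s : Finset ι) (f : ι → Fun 𝕜) :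
    comm q n k (∑ i ∈ s, f i) = ∑ i ∈ s, comm q n k (f i) :=
  map_sum (commHom q n k) f s

theorem comm_zero_left (q : QParam 𝕜) (k : ℕ) (f : Fun 𝕜) :
    comm q 0 k f = if k = 0 then f else 0 := by
  cases k with
  | zero => simp [comm_zero_right]
  | succ k =>
    have : qBinom q 0 (k + 1) = 0 := by
      simp [qBinom, Finset.prod_range_succ', qNum]
    simp [comm, this]

theorem Dq_sum (q : QParam 𝕜) {ι : Type*} (s : Finset ι) (f : ι → Fun 𝕜) :
    Dq q (∑ i ∈ s, f i) = ∑ i ∈ s, Dq q (f i) :=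
  map_sum (AddMonoidHom.mk' (Dq q) (Dq_add q)) f s

/-- If two families satisfy the recursion of `comm` in `n`, they agree once they agree at `0`. -/
theorem rec_unique (q : QParam 𝕜) (F G : ℤ → ℕ → Fun 𝕜) (h0 : ∀ k, F 0 k = G 0 k)
    (hF0 : ∀ n, F (n + 1) 0 = D q (F n 0)) (hG0 : ∀ n, G (n + 1) 0 = D q (G n 0))
    (hF : ∀ n k, F (n + 1) (k + 1) = D q (F n (k + 1)) + Dq q (F n k))
    (hG : ∀ n k, G (n + 1) (k + 1) = D q (G n (k + 1)) + Dq q (G n k)) (n : ℤ) (k : ℕ) :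
    F n k = G n k := by
  induction n generalizing k with
  | zero => exact h0 k
  | succ n ih =>
    cases k with
    | zero => rw [hF0, hG0, ih]
    | succ k => rw [hF, hG, ih, ih]
  | pred n ih =>
    have e : -(n : ℤ) - 1 + 1 = -n := by ring
    induction k with
    | zero =>
      apply (D q).injective
      rw [← hF0, ← hG0, e, ih]
    | succ k ihk =>
      apply (D q).injective
      have h1 := hF (-(n : ℤ) - 1) k
      have h2 := hG (-(n : ℤ) - 1) k
      rw [e] at h1 h2
      rw [ih, h2, ihk] at h1
      exact (add_right_cancel h1).symm

/-- `D_q^n ∘ (f g) = (D_q^n ∘ f) ∘ g`. -/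
theorem comm_mul (q : QParam 𝕜) (f g : Fun 𝕜) (n : ℤ) (m : ℕ) :
    comm q n m (f * g) =
      ∑ p ∈ antidiagonal m, comm q n p.1 f * comm q (n - p.1) p.2 g := by
  refine rec_unique q (fun n m => comm q n m (f * g))
    (fun n m => ∑ p ∈ antidiagonal m, comm q n p.1 f * comm q (n - p.1) p.2 g)
    ?_ ?_ ?_ ?_ ?_ n m
  · intro k
    simp only [comm_zero_left]
    cases k with
    | zero => simp [comm_zero_left]
    | succ k =>
      rw [Finset.Nat.sum_antidiagonal_succ]
      simp [comm_zero_left]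
  · exact fun n => comm_succ_zero q n _
  · intro n
    simp only [Finset.Nat.antidiagonal_zero, Finset.sum_singleton, Nat.cast_zero, sub_zero,
      comm_succ_zero, map_mul]
  · exact fun n k => comm_succ_succ q n k _
  · intro n k
    rw [Finset.Nat.sum_antidiagonal_succ, map_sum, Dq_sum]
    simp only [map_mul, Dq_mul]
    rw [Finset.Nat.sum_antidiagonal_succ, Finset.sum_add_distrib]
    have e : ∀ i : ℕ, n + 1 - ((i + 1 : ℕ) : ℤ) = n - i := fun i => by push_cast; ring
    simp only [e, comm_succ_succ, comm_succ_zero, Nat.cast_zero, sub_zero, add_mul,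
      Finset.sum_add_distrib]
    have key : ∑ p ∈ antidiagonal k, D q (comm q n (p.1 + 1) f) * comm q (n - p.1) p.2 g
        + D q (comm q n 0 f) * Dq q (comm q n k g)
        = ∑ p ∈ antidiagonal k,
            D q (comm q n (p.1 + 1) f) * D q (comm q (n - ((p.1 + 1 : ℕ) : ℤ)) p.2 g)
          + ∑ p ∈ antidiagonal k,
            D q (comm q n p.1 f) * Dq q (comm q (n - p.1) p.2 g) := by
      have e2 : ∀ i : ℕ, n - (i : ℤ) = n - ((i + 1 : ℕ) : ℤ) + 1 := fun i => by push_cast; ring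
      cases k with
      | zero =>
        simp only [Finset.Nat.antidiagonal_zero, Finset.sum_singleton, Nat.cast_zero, sub_zero]
        have := comm_succ_zero q (n - ((0 + 1 : ℕ) : ℤ)) g
        rw [← e2] at this
        simp only [Nat.cast_zero, sub_zero] at this
        rw [this]
      | succ k =>
        rw [Finset.Nat.sum_antidiagonal_succ' (n := k), Finset.Nat.sum_antidiagonal_succ' (n := k),
          Finset.Nat.sum_antidiagonal_succ (n := k)]
        have h1 : ∀ (i j : ℕ), comm q (n - i) (j + 1) g =
            D q (comm q (n - ((i + 1 : ℕ) : ℤ)) (j + 1) g)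
              + Dq q (comm q (n - ((i + 1 : ℕ) : ℤ)) j g) := by
          intro i j; rw [e2 i, comm_succ_succ]
        have h2 : ∀ i : ℕ, comm q (n - i) 0 g = D q (comm q (n - ((i + 1 : ℕ) : ℤ)) 0 g) := by
          intro i; rw [e2 i, comm_succ_zero]
        have s1 : ∑ p ∈ antidiagonal k,
            D q (comm q n (p.1 + 1) f) * comm q (n - p.1) (p.2 + 1) g =
            ∑ p ∈ antidiagonal k, D q (comm q n (p.1 + 1) f) *
                D q (comm q (n - ((p.1 + 1 : ℕ) : ℤ)) (p.2 + 1) g) +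
            ∑ p ∈ antidiagonal k, D q (comm q n (p.1 + 1) f) *
                Dq q (comm q (n - ((p.1 + 1 : ℕ) : ℤ)) p.2 g) := by
          rw [← Finset.sum_add_distrib]
          refine Finset.sum_congr rfl fun p _ => ?_
          rw [h1, mul_add]
        rw [s1, h2 (k + 1)]
        simp only [Nat.cast_zero, sub_zero]
        ring
    linear_combination key

/-- `D_q^i ∘ (D_q^j ∘ f) = D_q^(i+j) ∘ f`. -/
theorem comm_comm (q : QParam 𝕜) (j : ℤ) (f : Fun 𝕜) (i : ℤ) (m : ℕ) :
    ∑ p ∈ antidiagonal m, comm q i p.1 (comm q j p.2 f) = comm q (i + j) m f := by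
  refine rec_unique q
    (fun i m => ∑ p ∈ antidiagonal m, comm q i p.1 (comm q j p.2 f))
    (fun i m => comm q (i + j) m f) ?_ ?_ ?_ ?_ ?_ i m
  · intro k
    cases k with
    | zero => simp [comm_zero_left]
    | succ k => simp [Finset.Nat.sum_antidiagonal_succ, comm_zero_left]
  · intro n; simp [comm_succ_zero]
  · intro n
    rw [add_right_comm, comm_succ_zero]
  · intro n k
    rw [Finset.Nat.sum_antidiagonal_succ, Finset.Nat.sum_antidiagonal_succ, map_add, map_sum,
      Dq_sum]
    simp only [comm_succ_succ, comm_succ_zero, Finset.sum_add_distrib]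
    ring
  · intro n k
    rw [add_right_comm, comm_succ_succ]

namespace PDO

variable {q : QParam 𝕜}

/-- `a` has order at most `N`. -/
def Le (a : PDO q) (N : ℤ) : Prop := ∀ n, N < n → a.coeff n = 0

theorem exists_le (a : PDO q) : ∃ N, a.Le N := a.bdd

theorem exists_le₂ (a b : PDO q) : ∃ N, a.Le N ∧ b.Le N := by
  obtain ⟨N, hN⟩ := a.bdd
  obtain ⟨M, hM⟩ := b.bdd
  exact ⟨max N M, fun n hn => hN n (lt_of_le_of_lt (le_max_left _ _) hn),
    fun n hn => hM n (lt_of_le_of_lt (le_max_right _ _) hn)⟩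

/-- The coefficient of `D_q^n` in the product `(∑ a_i D_q^i)(∑ b_j D_q^j)`: the sum of
`a_i · comm q i k b_j` over all `i, j, k` with `i + j - k = n`. Only finitely many terms are
nonzero. -/
def mulCoeff (a b : PDO q) (n : ℤ) : Fun 𝕜 :=
  ∑ᶠ p : ℤ × ℕ, a.coeff p.1 * comm q p.1 p.2 (b.coeff (n - p.1 + p.2))

theorem mulCoeff_eq (a b : PDO q) {A B : ℤ} (ha : a.Le A) (hb : b.Le B) (m : ℕ) :
    mulCoeff a b (A + B - m) = ∑ x ∈ antidiagonal m, ∑ y ∈ antidiagonal x.2,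
      a.coeff (A - x.1) * comm q (A - x.1) y.2 (b.coeff (B - y.1)) := by
  have hs : Function.support (fun p : ℤ × ℕ =>
      a.coeff p.1 * comm q p.1 p.2 (b.coeff (A + B - m - p.1 + p.2))) ⊆
      ↑(Finset.Icc (A - m) A ×ˢ Finset.range (m + 1)) := by
    rintro ⟨i, k⟩ h
    simp only [Function.mem_support] at h
    have h1 : i ≤ A := by
      by_contra hc
      exact h (by rw [ha i (by omega), zero_mul])
    have h2 : A + B - m - i + k ≤ B := by
      by_contra hc
      exact h (by rw [hb _ (by omega), comm_zero, mul_zero])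
    simp only [Finset.coe_product, Set.mem_prod, Finset.mem_coe, Finset.mem_Icc,
      Finset.mem_range]
    omega
  rw [mulCoeff, finsum_eq_sum_of_support_subset _ hs, Finset.sum_sigma']
  symm
  refine Finset.sum_of_injOn (fun z : (_ : ℕ × ℕ) × (ℕ × ℕ) => (A - (z.1.1 : ℤ), z.2.2))
    ?_ ?_ ?_ ?_
  · rintro ⟨⟨i, r⟩, ⟨j, k⟩⟩ h ⟨⟨i', r'⟩, ⟨j', k'⟩⟩ h' he
    simp only [Finset.coe_sigma, Set.mem_sigma_iff, Finset.mem_coe,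
      Finset.HasAntidiagonal.mem_antidiagonal, Prod.mk.injEq] at h h' he
    obtain ⟨h1, h2⟩ := h
    obtain ⟨h3, h4⟩ := h'
    obtain ⟨h5, h6⟩ := he
    have : i = i' := by omega
    have : r = r' := by omega
    have : j = j' := by omega
    subst_vars
    rfl
  · rintro ⟨⟨i, r⟩, ⟨j, k⟩⟩ h
    simp only [Finset.coe_sigma, Set.mem_sigma_iff, Finset.mem_coe,
      Finset.HasAntidiagonal.mem_antidiagonal] at h
    simp only [Finset.coe_product, Set.mem_prod, Finset.mem_coe, Finset.mem_Icc,
      Finset.mem_range]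
    omega
  · rintro ⟨i, k⟩ h hn
    simp only [Finset.mem_product, Finset.mem_Icc, Finset.mem_range] at h
    by_cases hc : A + B - m - i + k ≤ B
    · exfalso
      apply hn
      refine ⟨⟨((A - i).toNat, m - (A - i).toNat), (m - (A - i).toNat - k, k)⟩, ?_, ?_⟩
      · simp only [Finset.coe_sigma, Set.mem_sigma_iff, Finset.mem_coe,
          Finset.HasAntidiagonal.mem_antidiagonal]
        omega
      · simp only [Prod.mk.injEq, and_true]
        omega
    · rw [hb _ (by omega), comm_zero, mul_zero]
  · rintro ⟨⟨i, r⟩, ⟨j, k⟩⟩ h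
    simp only [Finset.mem_sigma, Finset.HasAntidiagonal.mem_antidiagonal] at h
    obtain ⟨h1, h2⟩ := h
    have : A + B - m - (A - (i : ℤ)) + k = B - j := by omega
    simp only [this]

theorem mulCoeff_le (a b : PDO q) {A B : ℤ} (ha : a.Le A) (hb : b.Le B) (n : ℤ)
    (hn : A + B < n) : mulCoeff a b n = 0 := by
  rw [mulCoeff]
  refine finsum_eq_zero_of_forall_eq_zero ?_
  rintro ⟨i, k⟩
  by_cases h : A < i
  · simp only [ha i h, zero_mul]
  · simp only [hb (n - i + k) (by omega), comm_zero, mul_zero]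

instance : Mul (PDO q) where
  mul a b := ⟨mulCoeff a b, by
    obtain ⟨A, hA⟩ := a.exists_le
    obtain ⟨B, hB⟩ := b.exists_le
    exact ⟨A + B, mulCoeff_le a b hA hB⟩⟩

theorem mul_le {a b : PDO q} {A B : ℤ} (ha : a.Le A) (hb : b.Le B) : (a * b).Le (A + B) :=
  mulCoeff_le a b ha hb

theorem coeff_mul (a b : PDO q) {A B : ℤ} (ha : a.Le A) (hb : b.Le B) (m : ℕ) :
    (a * b).coeff (A + B - m) = ∑ x ∈ antidiagonal m, ∑ y ∈ antidiagonal x.2,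
      a.coeff (A - x.1) * comm q (A - x.1) y.2 (b.coeff (B - y.1)) :=
  mulCoeff_eq a b ha hb m

/-- The operator `f · D_q^n`. -/
def single (q : QParam 𝕜) (n : ℤ) (f : Fun 𝕜) : PDO q :=
  ⟨fun i => if i = n then f else 0, n, fun i hi => if_neg (by omega)⟩

instance : Zero (PDO q) := ⟨⟨fun _ => 0, 0, fun _ _ => rfl⟩⟩
instance : One (PDO q) := ⟨single q 0 1⟩
instance : Add (PDO q) := ⟨fun a b => ⟨fun n => a.coeff n + b.coeff n, by
  obtain ⟨N, h1, h2⟩ := exists_le₂ a b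
  exact ⟨N, fun n hn => by rw [h1 n hn, h2 n hn, add_zero]⟩⟩⟩
instance : Neg (PDO q) := ⟨fun a => ⟨fun n => - a.coeff n, by
  obtain ⟨N, h1⟩ := a.exists_le
  exact ⟨N, fun n hn => by rw [h1 n hn, neg_zero]⟩⟩⟩

theorem coeff_zero (n : ℤ) : (0 : PDO q).coeff n = 0 := rfl
theorem coeff_one (n : ℤ) : (1 : PDO q).coeff n = if n = 0 then 1 else 0 := rfl
theorem coeff_add (a b : PDO q) (n : ℤ) : (a + b).coeff n = a.coeff n + b.coeff n := rfl
theorem coeff_neg (a : PDO q) (n : ℤ) : (-a).coeff n = - a.coeff n := rfl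

theorem ext_of_le {a b : PDO q} {N : ℤ} (ha : a.Le N) (hb : b.Le N)
    (h : ∀ m : ℕ, a.coeff (N - m) = b.coeff (N - m)) : a = b := by
  ext n
  by_cases hn : N < n
  · rw [ha n hn, hb n hn]
  · have := h (N - n).toNat
    rwa [show N - ((N - n).toNat : ℤ) = n by omega] at this

theorem add_le {a b : PDO q} {N : ℤ} (ha : a.Le N) (hb : b.Le N) : (a + b).Le N :=
  fun n hn => by rw [coeff_add, ha n hn, hb n hn, add_zero]

theorem one_le : (1 : PDO q).Le 0 := fun n hn => by rw [coeff_one, if_neg (by omega)]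

theorem zero_le (N : ℤ) : (0 : PDO q).Le N := fun _ _ => rfl

theorem mul_assoc' (a b c : PDO q) : a * b * c = a * (b * c) := by
  obtain ⟨A, hA⟩ := a.exists_le
  obtain ⟨B, hB⟩ := b.exists_le
  obtain ⟨C, hC⟩ := c.exists_le
  have hl := mul_le (mul_le hA hB) hC
  have hr := mul_le hA (mul_le hB hC)
  rw [← add_assoc] at hr
  refine ext_of_le hl hr fun m => ?_
  rw [coeff_mul _ _ (mul_le hA hB) hC, add_assoc, coeff_mul _ _ hA (mul_le hB hC)]
  simp only [coeff_mul _ _ hA hB, coeff_mul _ _ hB hC, comm_sum, comm_mul, Finset.sum_mul,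
    Finset.mul_sum]
  have hc : ∀ x ∈ antidiagonal m, ∀ y ∈ antidiagonal x.2, ∀ u ∈ antidiagonal x.1,
      ∀ v ∈ antidiagonal u.2,
      a.coeff (A - u.1) * comm q (A - u.1) v.2 (b.coeff (B - v.1))
        * comm q (A + B - x.1) y.2 (c.coeff (C - y.1)) =
      ∑ w ∈ antidiagonal y.2, a.coeff (A - u.1) * comm q (A - u.1) v.2 (b.coeff (B - v.1))
        * comm q (A - u.1 - v.2) w.1 (comm q (B - v.1) w.2 (c.coeff (C - y.1))) := by
    intro x _ y _ u hu v hv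
    rw [Finset.HasAntidiagonal.mem_antidiagonal] at hu hv
    rw [← Finset.mul_sum, comm_comm]
    congr 3
    omega
  rw [Finset.sum_congr rfl fun x hx => Finset.sum_congr rfl fun y hy =>
    Finset.sum_congr rfl fun u hu => Finset.sum_congr rfl fun v hv => hc x hx y hy u hu v hv]
  simp only [Finset.sum_sigma']
  refine Finset.sum_nbij'
    (fun z => ⟨(z.2.2.1.1, z.2.2.2.1.1 + z.2.2.2.1.2 + z.2.1.1 + z.2.1.2),
      (z.2.2.2.1.1 + z.2.1.1 + z.2.2.2.2.2, z.2.2.2.1.2 + z.2.2.2.2.1),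
      (z.2.2.2.1.1, z.2.1.1 + z.2.2.2.2.2), (z.2.1.1, z.2.2.2.2.2),
      (z.2.2.2.1.2, z.2.2.2.2.1)⟩)
    (fun z => ⟨(z.1.1 + z.2.2.1.1 + z.2.2.2.2.1, z.2.2.2.1.1 + z.2.2.2.2.2 + z.2.2.2.1.2),
      (z.2.2.2.1.1, z.2.2.2.2.2 + z.2.2.2.1.2), (z.1.1, z.2.2.1.1 + z.2.2.2.2.1),
      (z.2.2.1.1, z.2.2.2.2.1), (z.2.2.2.2.2, z.2.2.2.1.2)⟩) ?_ ?_ ?_ ?_ ?_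
  · rintro ⟨⟨x1, x2⟩, ⟨y1, y2⟩, ⟨u1, u2⟩, ⟨v1, v2⟩, ⟨w1, w2⟩⟩ h
    simp only [Finset.mem_sigma, Finset.HasAntidiagonal.mem_antidiagonal] at h ⊢
    obtain ⟨h1, h2, h3, h4, h5⟩ := h
    exact ⟨by omega, by omega, by omega, trivial, trivial⟩
  · rintro ⟨⟨x1, x2⟩, ⟨y1, y2⟩, ⟨u1, u2⟩, ⟨v1, v2⟩, ⟨w1, w2⟩⟩ h
    simp only [Finset.mem_sigma, Finset.HasAntidiagonal.mem_antidiagonal] at h ⊢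
    obtain ⟨h1, h2, h3, h4, h5⟩ := h
    exact ⟨by omega, by omega, by omega, trivial, trivial⟩
  · rintro ⟨⟨x1, x2⟩, ⟨y1, y2⟩, ⟨u1, u2⟩, ⟨v1, v2⟩, ⟨w1, w2⟩⟩ h
    simp only [Finset.mem_sigma, Finset.HasAntidiagonal.mem_antidiagonal] at h
    obtain ⟨h1, h2, h3, h4, h5⟩ := h
    simp only [Sigma.mk.injEq, Prod.mk.injEq, heq_eq_eq, and_true]
    exact ⟨⟨by omega, by omega⟩, ⟨trivial, h5⟩, trivial, h4⟩
  · rintro ⟨⟨x1, x2⟩, ⟨y1, y2⟩, ⟨u1, u2⟩, ⟨v1, v2⟩, ⟨w1, w2⟩⟩ h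
    simp only [Finset.mem_sigma, Finset.HasAntidiagonal.mem_antidiagonal] at h
    simp only [Sigma.mk.injEq, Prod.mk.injEq, heq_eq_eq, and_true, true_and]
    omega
  · rintro ⟨⟨x1, x2⟩, ⟨y1, y2⟩, ⟨u1, u2⟩, ⟨v1, v2⟩, ⟨w1, w2⟩⟩ h
    dsimp only
    ring

theorem one_mul' (a : PDO q) : 1 * a = a := by
  obtain ⟨A, hA⟩ := a.exists_le
  have h := mul_le one_le hA
  rw [zero_add] at h
  refine ext_of_le h hA fun m => ?_
  have := coeff_mul _ _ one_le hA m
  rw [zero_add] at this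
  rw [this, Finset.sum_eq_single (0, m), Finset.sum_eq_single (m, 0)]
  · simp [coeff_one, comm_zero_left]
  · rintro ⟨i, k⟩ h1 h2
    rw [Finset.HasAntidiagonal.mem_antidiagonal] at h1
    have hk : k ≠ 0 := by
      rintro rfl
      obtain rfl : i = m := by simpa using h1
      exact h2 rfl
    simp [comm_zero_left, hk]
  · intro h; exact absurd (Finset.HasAntidiagonal.mem_antidiagonal.2 (by simp)) h
  · rintro ⟨i, k⟩ h1 h2
    rw [Finset.HasAntidiagonal.mem_antidiagonal] at h1
    have hi : i ≠ 0 := by rintro rfl; exact h2 (by rw [← h1]; simp)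
    simp [coeff_one, hi]
  · intro h; exact absurd (Finset.HasAntidiagonal.mem_antidiagonal.2 (by simp)) h

theorem Dq_one : Dq q 1 = 0 := by simp [Dq]

theorem comm_one (n : ℤ) (k : ℕ) : comm q n k 1 = if k = 0 then 1 else 0 := by
  cases k with
  | zero => simp [comm_zero_right]
  | succ k =>
    have : (Dq q)^[k] 0 = 0 := by
      induction k with
      | zero => rfl
      | succ k ih => rw [Function.iterate_succ_apply]; simpa [Dq] using ih
    simp [comm, Dq_one, this]

theorem mul_one' (a : PDO q) : a * 1 = a := by
  obtain ⟨A, hA⟩ := a.exists_le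
  have h := mul_le hA one_le
  rw [add_zero] at h
  refine ext_of_le h hA fun m => ?_
  have := coeff_mul _ _ hA one_le m
  rw [add_zero] at this
  rw [this, Finset.sum_eq_single (m, 0)]
  · simp [coeff_one, comm_one]
  · rintro ⟨i, k⟩ h1 h2
    rw [Finset.HasAntidiagonal.mem_antidiagonal] at h1
    refine Finset.sum_eq_zero ?_
    rintro ⟨j, l⟩ h3
    rw [Finset.HasAntidiagonal.mem_antidiagonal] at h3
    dsimp only at h1 h3 ⊢
    rw [coeff_one]
    split_ifs with hj
    · have hl : l ≠ 0 := by
        rintro rfl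
        apply h2
        have : k = 0 := by omega
        rw [this] at h1 ⊢
        rw [← h1]; simp
      simp [comm_one, hl]
    · simp [comm_zero]
  · intro h; exact absurd (Finset.HasAntidiagonal.mem_antidiagonal.2 (by simp)) h

theorem left_distrib' (a b c : PDO q) : a * (b + c) = a * b + a * c := by
  obtain ⟨A, hA⟩ := a.exists_le
  obtain ⟨B, hB, hC⟩ := exists_le₂ b c
  refine ext_of_le (mul_le hA (add_le hB hC)) (add_le (mul_le hA hB) (mul_le hA hC)) fun m => ?_
  rw [coeff_add, coeff_mul _ _ hA (add_le hB hC), coeff_mul _ _ hA hB, coeff_mul _ _ hA hC]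
  simp only [coeff_add, comm_add, mul_add, Finset.sum_add_distrib]

theorem right_distrib' (a b c : PDO q) : (a + b) * c = a * c + b * c := by
  obtain ⟨C, hC⟩ := c.exists_le
  obtain ⟨A, hA, hB⟩ := exists_le₂ a b
  refine ext_of_le (mul_le (add_le hA hB) hC) (add_le (mul_le hA hC) (mul_le hB hC)) fun m => ?_
  rw [coeff_add, coeff_mul _ _ (add_le hA hB) hC, coeff_mul _ _ hA hC, coeff_mul _ _ hB hC]
  simp only [coeff_add, add_mul, Finset.sum_add_distrib]

/-- The ring of formal pseudo-`q`-difference operators. -/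
instance : Ring (PDO q) where
  add_assoc a b c := by ext n; exact add_assoc _ _ _
  zero_add a := by ext n; exact zero_add _
  add_zero a := by ext n; exact add_zero _
  add_comm a b := by ext n; exact add_comm _ _
  neg_add_cancel a := by ext n; exact neg_add_cancel _
  nsmul := nsmulRec
  zsmul := zsmulRec
  left_distrib := left_distrib'
  right_distrib := right_distrib'
  zero_mul a := by
    ext n
    exact finsum_eq_zero_of_forall_eq_zero fun p => by rw [coeff_zero, zero_mul]
  mul_zero a := by
    ext n
    exact finsum_eq_zero_of_forall_eq_zero fun p => by rw [coeff_zero, comm_zero, mul_zero]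
  mul_assoc := mul_assoc'
  one_mul := one_mul'
  mul_one := mul_one'

end PDO

/-! ### Derivatives in `t₁, t₂, …` and elementary Schur polynomials -/

/-- The partial derivative `∂_k = ∂/∂t_k` on power series in `x, t₁, t₂, …`. -/
def dt (k : ℕ+) : Module.End 𝕜 (Ser 𝕜) := (MvPowerSeries.pderiv 𝕜 (some k)).toLinearMap

/-- The extension of `∂_k` to the field of fractions by the quotient rule
`∂_k (a/b) = ((∂_k a) b - a (∂_k b)) / b²`. -/
def dtFun (k : ℕ+) (f : Fun 𝕜) : Fun 𝕜 :=
  let r := IsLocalization.sec (nonZeroDivisors (Ser 𝕜)) f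
  let a : Ser 𝕜 := r.1
  let b : Ser 𝕜 := (r.2 : Ser 𝕜)
  toFun (dt k a * b - a * dt k b) / toFun b ^ 2

theorem dtFun_div (k : ℕ+) (a b : Ser 𝕜) (hb : b ≠ 0) :
    dtFun k (toFun a / toFun b) = toFun (dt k a * b - a * dt k b) / toFun b ^ 2 := by
  have inj := IsFractionRing.injective (Ser 𝕜) (Fun 𝕜)
  rw [dtFun]
  set r := IsLocalization.sec (nonZeroDivisors (Ser 𝕜)) (toFun a / toFun b : Fun 𝕜) with hr
  obtain ⟨c, d⟩ := r
  have hd : (d : Ser 𝕜) ≠ 0 := nonZeroDivisors.ne_zero d.2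
  have hd' : toFun (d : Ser 𝕜) ≠ 0 := fun h => hd (inj (by rw [map_zero]; exact h))
  have hb' : toFun b ≠ 0 := fun h => hb (inj (by rw [map_zero]; exact h))
  have h := IsLocalization.sec_spec (nonZeroDivisors (Ser 𝕜)) (toFun a / toFun b : Fun 𝕜)
  rw [← hr] at h
  dsimp only at h ⊢
  have h2 : a * (d : Ser 𝕜) = c * b := by
    apply inj
    rw [map_mul, map_mul]
    change toFun a * toFun (d : Ser 𝕜) = toFun c * toFun b
    change toFun a / toFun b * toFun (d : Ser 𝕜) = toFun c at h
    rw [← h]; field_simp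
  have h3 : a * dt k (d : Ser 𝕜) + (d : Ser 𝕜) * dt k a = c * dt k b + b * dt k c := by
    have := congrArg (MvPowerSeries.pderiv 𝕜 (some k)) h2
    rw [Derivation.leibniz, Derivation.leibniz] at this
    exact this
  rw [div_eq_div_iff (pow_ne_zero 2 hd') (pow_ne_zero 2 hb')]
  simp only [toFun, ← map_mul, ← map_pow]
  congr 1
  linear_combination (-(b * (d : Ser 𝕜))) * h3 + (b * dt k (d : Ser 𝕜) + (d : Ser 𝕜) * dt k b) * h2

/-- The elementary Schur polynomial
`p_n(y) = ∑_{k₁ + 2k₂ + ⋯ + n kₙ = n} (y₁^k₁/k₁!) ⋯ (yₙ^kₙ/kₙ!)`, evaluated at operators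
`y₁, y₂, …`. -/
def schurOp (n : ℕ) (y : ℕ+ → Module.End 𝕜 (Ser 𝕜)) : Module.End 𝕜 (Ser 𝕜) :=
  ∑ k : Fin n → Fin (n + 1) with ∑ i : Fin n, ((i : ℕ) + 1) * (k i : ℕ) = n,
    (List.ofFn fun i : Fin n =>
      ((Nat.factorial (k i : ℕ) : 𝕜)⁻¹) • y ⟨(i : ℕ) + 1, Nat.succ_pos i⟩ ^ (k i : ℕ)).prod

/-- `-∂̃ = (-∂₁, -∂₂/2, -∂₃/3, …)`. -/
def negDtTilde (k : ℕ+) : Module.End 𝕜 (Ser 𝕜) := (-((k : ℕ) : 𝕜)⁻¹) • dt k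

/-! ### Tau functions, dressing and Lax operators -/

/-- For constants `c₁, c₂, …`, the series `τ(t₁ + c₁ x, t₂ + c₂ x², t₃ + c₃ x³, …)`. -/
def shiftTau (c : ℕ+ → 𝕜) (τ : MvPowerSeries ℕ+ 𝕜) : Ser 𝕜 :=
  MvPowerSeries.subst
    (fun k : ℕ+ => (MvPowerSeries.X (some k) + c k • MvPowerSeries.X none ^ (k : ℕ) : Ser 𝕜)) τ

theorem hasSubst_shift (c : ℕ+ → 𝕜) :
    MvPowerSeries.HasSubst
      (fun k : ℕ+ => (MvPowerSeries.X (some k) + c k • MvPowerSeries.X none ^ (k : ℕ) :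
        Ser 𝕜)) := by
  classical
  refine ⟨fun k => ?_, fun d => ?_⟩
  · simp
  · refine Set.Finite.subset (s := (fun v : Var => match v with
      | none => (⟨d none + 1, Nat.succ_pos _⟩ : ℕ+)
      | some k => k) '' ↑(d.support ∪ {none}) ∪
        {k : ℕ+ | (k : ℕ) = d none}) ?_ ?_
    · refine (Set.Finite.image _ (Finset.finite_toSet _)).union ?_
      refine Set.Finite.subset (Set.finite_le_nat (d none) |>.preimage
        (f := fun k : ℕ+ => (k : ℕ)) PNat.coe_injective.injOn) ?_
      intro k hk
      exact le_of_eq hk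
    · intro k hk
      by_contra hn
      apply hk
      simp only [Set.mem_union, not_or, Set.mem_ofPred_eq] at hn
      obtain ⟨h1, h2⟩ := hn
      have h3 : d ≠ Finsupp.single (some k) 1 := by
        rintro rfl
        exact h1 ⟨some k, by simp, rfl⟩
      have h4 : d ≠ Finsupp.single none (k : ℕ) := by
        rintro rfl
        exact h2 (by simp)
      rw [map_add, map_smul, MvPowerSeries.coeff_X, if_neg h3, MvPowerSeries.X_pow_eq,
        MvPowerSeries.coeff_monomial, if_neg h4]
      simp

/-- `τ_q(x,t) = τ(t + [x]_q)`, where `[x]_q` has `k`-th entry `(1-q)^k x^k / (k (1-q^k))`. -/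
def tauQ (q : QParam 𝕜) (τ : MvPowerSeries ℕ+ 𝕜) : Ser 𝕜 :=
  shiftTau (fun k => (1 - q.val) ^ (k : ℕ) / ((k : ℕ) * (1 - q.val ^ (k : ℕ)))) τ

/-- `τ(t₁ + x, t₂, t₃, …)`. -/
def tauOne (τ : MvPowerSeries ℕ+ 𝕜) : Ser 𝕜 := shiftTau (fun k => if k = 1 then 1 else 0) τ

/-- The dressing operator `S = ∑_{j ≥ 0} (p_j(-∂̃)τ_q / τ_q) D_q^(-j)`. -/
def dressing (q : QParam 𝕜) (τ : MvPowerSeries ℕ+ 𝕜) : PDO q where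
  coeff n :=
    if n ≤ 0 then toFun (schurOp n.natAbs negDtTilde (tauQ q τ)) / toFun (tauQ q τ) else 0
  bdd := ⟨0, fun n hn => if_neg (by omega)⟩

/-- The Lax operator `L = S D_q S⁻¹`. -/
def lax (q : QParam 𝕜) (τ : MvPowerSeries ℕ+ 𝕜) : PDO q :=
  dressing q τ * PDO.single q 1 1 * Ring.inverse (dressing q τ)

/-! ### Limits in the field of fractions -/

/-- Coefficientwise convergence of formal power series. -/
def SerTendsto [TopologicalSpace 𝕜] {ι : Type*} (l : Filter ι) (f : ι → Ser 𝕜) (g : Ser 𝕜) :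
    Prop :=
  ∀ d : Var →₀ ℕ, Tendsto (fun i => MvPowerSeries.coeff d (f i)) l (𝓝 (MvPowerSeries.coeff d g))

/-- Convergence in the field of fractions: `f i → g` if one can write `f i = a i / b i` and
`g = a₀ / b₀` with `a i → a₀` and `b i → b₀ ≠ 0` coefficientwise. -/
def FunTendsto [TopologicalSpace 𝕜] {ι : Type*} (l : Filter ι) (f : ι → Fun 𝕜) (g : Fun 𝕜) :
    Prop :=
  ∃ (a b : ι → Ser 𝕜) (a₀ b₀ : Ser 𝕜), b₀ ≠ 0 ∧ SerTendsto l a a₀ ∧ SerTendsto l b b₀ ∧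
    (∀ᶠ i in l, b i ≠ 0 ∧ f i = toFun (a i) / toFun (b i)) ∧ g = toFun a₀ / toFun b₀

/-- The filter `q → 1` on admissible values of `q`. -/
def qToOne (𝕜 : Type*) [Field 𝕜] [TopologicalSpace 𝕜] : Filter (QParam 𝕜) :=
  comap QParam.val (𝓝 1)

end QKP

end

noncomputable section

namespace QKP

open Finset.HasAntidiagonal (antidiagonal)

variable {𝕜 : Type*} [Field 𝕜]

/-! Write `S = 1 + s₁ D_q⁻¹ + s₂ D_q⁻² + ⋯`. An operator of order `0` with leading coefficient `1`
has a right inverse, obtained by solving for its coefficients recursively. Associativity makes this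
inverse two-sided, so `S` is invertible. `L = S D_q S⁻¹` then satisfies `L S = S D_q`, and the
coefficients of `D_q`, `1`, `D_q⁻¹` in this identity determine those of `L` (`PDO.coeff_conj`). The
result is `u = s₂ - D s₂ - D_q s₁ - (s₁ - D s₁) s₁`. Inserting `s₁ = p₁(-∂̃)τ_q / τ_q = -∂₁τ_q /
τ_q` and `s₂ = p₂(-∂̃)τ_q / τ_q` gives the first formula. The second follows from `(q-1) x D_q f = D
f - f`.

For the limit, `u` is written as a quotient of power series whose denominator is free of the factor
`(q-1)x` (`coordinate_eq_div`). Numerator and denominator then converge coefficientwise, for three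
reasons. The constants `(1-q)^k / (k(1-q^k))` tend to `1` for `k = 1` and to `0` otherwise, so `τ_q
→ τ(t₁ + x, t₂, …)` (`tendsto_tauQ`). The scaling `D` tends to the identity. The `q`-derivative
tends to `∂_x` because `[n]_q → n` (`SerTendsto.qDerivSer`). In the limit the terms without a
`q`-derivative cancel, leaving `∂_x(∂₁τ/τ)`, and on a function of `t₁ + x` the derivative `∂_x`
equals `∂₁` (`pderiv_none_tauOne`).

Convergence of `τ_q` is a statement about finite sums. The factors `t_k + c_k x^k` are homogeneous
of weight `k`, so a fixed coefficient of the shifted series involves a finite set of monomials of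
`τ` that does not depend on `c` (`coeff_shiftTau_eq_sum`). -/

namespace PDO

/-! ### Inversion of monic operators of order zero, and conjugation of `D_q` by them -/

variable {q : QParam 𝕜}

/-- `a` has order `0` and leading coefficient `1`. -/
def IsMonicZero (a : PDO q) : Prop := a.Le 0 ∧ a.coeff 0 = 1

/-- The coefficient of `D_q^(-m)` in the right inverse of a monic operator `a` of order `0`. -/
def rightInvCoeff (a : PDO q) (m : ℕ) : Fun 𝕜 :=
  (if m = 0 then 1 else 0) - ∑ x ∈ antidiagonal m, ∑ y ∈ antidiagonal x.2,
    if _h : y.1 < m then a.coeff (0 - x.1) * comm q (0 - x.1) y.2 (rightInvCoeff a y.1) else 0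
termination_by m

/-- The right inverse of a monic operator of order `0`. -/
def rightInv (a : PDO q) : PDO q where
  coeff n := if n ≤ 0 then rightInvCoeff a n.natAbs else 0
  bdd := ⟨0, fun n hn => if_neg (by omega)⟩

theorem rightInv_le (a : PDO q) : a.rightInv.Le 0 := fun n hn => if_neg (by omega)

theorem rightInv_coeff (a : PDO q) (m : ℕ) : a.rightInv.coeff (0 - m) = rightInvCoeff a m := by
  have h1 : (0 - (m : ℤ)) ≤ 0 := by omega
  have h2 : (0 - (m : ℤ)).natAbs = m := by omega
  simp only [rightInv, if_pos h1, h2]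

theorem IsMonicZero.rightInv {a : PDO q} (_ha : a.IsMonicZero) : a.rightInv.IsMonicZero := by
  refine ⟨rightInv_le a, ?_⟩
  have := rightInv_coeff a 0
  rw [Nat.cast_zero, sub_zero] at this
  rw [this, rightInvCoeff]
  simp

theorem IsMonicZero.mul_rightInv {a : PDO q} (ha : a.IsMonicZero) : a * a.rightInv = 1 := by
  have hl := mul_le ha.1 (rightInv_le a)
  rw [add_zero] at hl
  refine ext_of_le hl one_le fun m => ?_
  have h := coeff_mul _ _ ha.1 (rightInv_le a) m
  rw [add_zero] at h
  have hone : (1 : PDO q).coeff (0 - m) = if m = 0 then 1 else 0 := by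
    rw [coeff_one]; congr 1; simp
  rw [h, hone]
  simp only [rightInv_coeff]
  have hr := rightInvCoeff.eq_1 a m
  -- The guard `y.1 < m` in the recursion omits a single term: `y.1 = m` forces `x = (0, m)` and `y
  -- = (m, 0)`. There the factor `a.coeff 0` is `1`, so the omitted term is the new unknown itself.
  have hsplit : ∑ x ∈ antidiagonal m, ∑ y ∈ antidiagonal x.2,
      a.coeff (0 - x.1) * comm q (0 - x.1) y.2 (rightInvCoeff a y.1) =
      (∑ x ∈ antidiagonal m, ∑ y ∈ antidiagonal x.2, if _h : y.1 < m then
        a.coeff (0 - x.1) * comm q (0 - x.1) y.2 (rightInvCoeff a y.1) else 0) +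
      ∑ x ∈ antidiagonal m, ∑ y ∈ antidiagonal x.2, if y = (m, 0) then rightInvCoeff a m
        else 0 := by
    simp only [← Finset.sum_add_distrib]
    refine Finset.sum_congr rfl fun x hx => Finset.sum_congr rfl fun y hy => ?_
    obtain ⟨x1, x2⟩ := x
    obtain ⟨y1, y2⟩ := y
    rw [Finset.HasAntidiagonal.mem_antidiagonal] at hx hy
    dsimp only at hx hy ⊢
    by_cases hlt : y1 < m
    · rw [dif_pos hlt, if_neg (by rw [Prod.mk.injEq]; omega), add_zero]
    · obtain rfl : y1 = m := by omega
      obtain rfl : y2 = 0 := by omega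
      obtain rfl : x1 = 0 := by omega
      rw [dif_neg hlt, if_pos rfl]
      simp [ha.2, comm_zero_right]
  have hlast : ∑ x ∈ antidiagonal m, ∑ y ∈ antidiagonal x.2,
      (if y = (m, 0) then rightInvCoeff a m else 0) = rightInvCoeff a m := by
    rw [Finset.sum_eq_single (0, m), Finset.sum_eq_single (m, 0)]
    · simp
    · intro y _ hy; exact if_neg hy
    · intro h; exact absurd (Finset.HasAntidiagonal.mem_antidiagonal.2 (by simp)) h
    · rintro ⟨x1, x2⟩ hx hne
      refine Finset.sum_eq_zero fun y hy => if_neg ?_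
      rintro rfl
      rw [Finset.HasAntidiagonal.mem_antidiagonal] at hx hy
      apply hne
      dsimp only at hx hy
      rw [Prod.mk.injEq]; omega
    · intro h; exact absurd (Finset.HasAntidiagonal.mem_antidiagonal.2 (by simp)) h
  rw [hsplit, hlast, hr]
  ring

/-- The right inverse is again monic of order `0`, hence has its own right inverse, which by
associativity must be `a`. -/
theorem IsMonicZero.rightInv_mul {a : PDO q} (ha : a.IsMonicZero) : a.rightInv * a = 1 := by
  have h1 := ha.mul_rightInv
  have h2 := ha.rightInv.mul_rightInv
  have h3 : a.rightInv.rightInv = a := by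
    calc a.rightInv.rightInv = (a * a.rightInv) * a.rightInv.rightInv := by rw [h1, one_mul]
      _ = a := by rw [mul_assoc, h2, mul_one]
  rw [h3] at h2
  exact h2

theorem IsMonicZero.isUnit {a : PDO q} (ha : a.IsMonicZero) : IsUnit a :=
  ⟨⟨a, a.rightInv, ha.mul_rightInv, ha.rightInv_mul⟩, rfl⟩

theorem IsMonicZero.inverse {a : PDO q} (ha : a.IsMonicZero) :
    Ring.inverse a = a.rightInv :=
  Ring.inverse_unit ⟨a, a.rightInv, ha.mul_rightInv, ha.rightInv_mul⟩

theorem single_le (n : ℤ) (f : Fun 𝕜) : (single q n f).Le n := fun i hi => if_neg (by omega)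

theorem conj_le {a : PDO q} (ha : a.IsMonicZero) :
    (a * single q 1 1 * Ring.inverse a).Le 1 := by
  have := mul_le (mul_le ha.1 (single_le (q := q) 1 1)) (rightInv_le a)
  rw [ha.inverse]
  simpa using this

theorem comm_one_zero (f : Fun 𝕜) : comm q 1 0 f = D q f := by
  simp [comm_zero_right]

theorem comm_one_one (f : Fun 𝕜) : comm q 1 1 f = Dq q f := by
  have := comm_succ_succ q 0 0 f
  simpa [comm_zero_left, Dq, comm_zero] using this

/-- Comparing coefficients in `L S = S D_q` for `L = S D_q S⁻¹`, where
`S = 1 + s₁ D_q⁻¹ + s₂ D_q⁻² + ⋯`. -/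
theorem coeff_conj {a : PDO q} (ha : a.IsMonicZero) :
    (a * single q 1 1 * Ring.inverse a).coeff 1 = 1 ∧
    (a * single q 1 1 * Ring.inverse a).coeff (-1) =
      a.coeff (-2) - D q (a.coeff (-2)) - Dq q (a.coeff (-1))
        - (a.coeff (-1) - D q (a.coeff (-1))) * a.coeff (-1) := by
  have hL := conj_le ha
  have hmul : a * single q 1 1 * Ring.inverse a * a = a * single q 1 1 := by
    rw [ha.inverse, mul_assoc, ha.rightInv_mul, mul_one]
  set L := a * single q 1 1 * Ring.inverse a
  -- The indices keep the shape `A + B - m` of `coeff_mul`, with order bounds `(1, 0)` on the left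
  -- and `(0, 1)` on the right.
  have key : ∀ m : ℕ, (L * a).coeff (1 + 0 - m) = (a * single q 1 1).coeff (0 + 1 - m) := by
    intro m; rw [hmul]; congr 1
  -- Right multiplication by `D_q` only shifts degrees, since the constant coefficient `1` is killed
  -- by `D_q` and fixed by `D`.
  have hR : ∀ m : ℕ, (a * single q 1 1).coeff (0 + 1 - m) = a.coeff (0 - m) := by
    intro m
    rw [coeff_mul _ _ ha.1 (single_le 1 1), Finset.sum_eq_single (m, 0)]
    · simp [single, comm_zero_right]
    · rintro ⟨i, k⟩ hx hne
      rw [Finset.HasAntidiagonal.mem_antidiagonal] at hx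
      refine Finset.sum_eq_zero ?_
      rintro ⟨j, l⟩ hy
      rw [Finset.HasAntidiagonal.mem_antidiagonal] at hy
      dsimp only at hx hy ⊢
      have hk : k ≠ 0 := by
        rintro rfl
        exact hne (by rw [Prod.mk.injEq]; omega)
      by_cases hj : j = 0
      · have hl : l ≠ 0 := by omega
        simp [single, hj, comm_one, hl]
      · simp [single, hj, comm_zero]
    · intro h; exact absurd (Finset.HasAntidiagonal.mem_antidiagonal.2 (by simp)) h
  simp only [hR, coeff_mul _ _ hL ha.1] at key
  -- With `L = l₁ D_q + l₀ + l₋₁ D_q⁻¹ + ⋯`, these become `l₁ = 1`, `l₁ D s₁ + l₀ = s₁` and `l₁ (D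
  -- s₂ + D_q s₁) + l₀ s₁ + l₋₁ = s₂`. Subtracting `s₁` times the second from the third eliminates
  -- `l₀`.
  have k0 := key 0
  have k1 := key 1
  have k2 := key 2
  simp [Finset.Nat.antidiagonal_succ, ha.2, comm_one, comm_one_zero, comm_one_one,
    comm_zero_left] at k0 k1 k2
  rw [k0] at k1 k2
  refine ⟨k0, ?_⟩
  linear_combination k2 - a.coeff (-1) * k1

end PDO

/-! ### The Schur polynomials `p₀`, `p₁`, `p₂` -/

section Schur

theorem schurOp_zero (y : ℕ+ → Module.End 𝕜 (Ser 𝕜)) : schurOp 0 y = 1 := by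
  simp [schurOp]

theorem schurOp_one (y : ℕ+ → Module.End 𝕜 (Ser 𝕜)) : schurOp 1 y = y 1 := by
  have h : (Finset.univ.filter fun k : Fin 1 → Fin 2 =>
      ∑ i : Fin 1, ((i : ℕ) + 1) * (k i : ℕ) = 1) = {![1]} := by decide
  rw [schurOp, h, Finset.sum_singleton]
  simp

theorem schurOp_two (y : ℕ+ → Module.End 𝕜 (Ser 𝕜)) :
    schurOp 2 y = (2 : 𝕜)⁻¹ • y 1 ^ 2 + y 2 := by
  -- The two exponent vectors are the partitions `1 + 1` and `2`.
  have h : (Finset.univ.filter fun k : Fin 2 → Fin 3 =>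
      ∑ i : Fin 2, ((i : ℕ) + 1) * (k i : ℕ) = 2) = {![2, 0], ![0, 1]} := by decide
  rw [schurOp, h, Finset.sum_pair (by decide)]
  simp

theorem schurOp_one_negDtTilde (f : Ser 𝕜) : schurOp 1 negDtTilde f = -dt 1 f := by
  simp [schurOp_one, negDtTilde]

theorem schurOp_two_negDtTilde (f : Ser 𝕜) :
    schurOp 2 negDtTilde f = (1 / 2 : 𝕜) • (dt 1 (dt 1 f) - dt 2 f) := by
  simp [schurOp_two, negDtTilde, pow_two, sub_eq_add_neg]

end Schur

/-! ### The shifted series: injectivity, weighted homogeneity, derivatives -/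

section Shift

/-- Restricting `τ(t₁ + c₁ x, t₂ + c₂ x², …)` to `x = 0` recovers `τ`. -/
theorem shiftTau_injective (c : ℕ+ → 𝕜) : Function.Injective (shiftTau c) := by
  classical
  let z : Var → MvPowerSeries ℕ+ 𝕜 := fun v => v.elim 0 MvPowerSeries.X
  have hz : MvPowerSeries.HasSubst z := by
    refine ⟨fun v => ?_, fun d => ?_⟩
    · cases v <;> simp [z]
    · refine Set.Finite.subset ((Finset.finite_toSet d.support).image some) ?_
      rintro (_ | k) hk
      · simp [z] at hk
      · refine ⟨k, ?_, rfl⟩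
        have h1 : MvPowerSeries.coeff d (MvPowerSeries.X k : MvPowerSeries ℕ+ 𝕜) ≠ 0 := hk
        rw [MvPowerSeries.coeff_X] at h1
        have h2 : d = Finsupp.single k 1 := by
          by_contra hne
          exact h1 (if_neg hne)
        simp [h2]
  have hl : ∀ τ, MvPowerSeries.subst z (shiftTau c τ) = τ := by
    intro τ
    rw [shiftTau, MvPowerSeries.subst_comp_subst_apply (hasSubst_shift c) hz]
    have : (fun k : ℕ+ => MvPowerSeries.subst z
        (MvPowerSeries.X (some k) + c k • MvPowerSeries.X none ^ (k : ℕ) : Ser 𝕜)) =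
        (MvPowerSeries.X : ℕ+ → MvPowerSeries ℕ+ 𝕜) := by
      funext k
      rw [MvPowerSeries.subst_add hz, MvPowerSeries.subst_smul hz, MvPowerSeries.subst_pow hz,
        MvPowerSeries.subst_X hz, MvPowerSeries.subst_X hz]
      -- `z` sends `x` to `0`, and the indices `k` are positive, so every `c_k x^k` disappears.
      simp [z]
    rw [this, MvPowerSeries.subst_self]
    rfl
  exact Function.LeftInverse.injective hl

theorem shiftTau_ne_zero (c : ℕ+ → 𝕜) {τ : MvPowerSeries ℕ+ 𝕜} (hτ : τ ≠ 0) :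
    shiftTau c τ ≠ 0 := by
  have h0 : shiftTau c 0 = 0 := by
    rw [shiftTau, ← MvPowerSeries.substAlgHom_apply (hasSubst_shift c), map_zero]
  exact fun h => hτ (shiftTau_injective c (h.trans h0.symm))

/-- The factor of `∏ (t_k + c_k x^k)^(d_k)`. -/
def shiftVar (c : ℕ+ → 𝕜) (k : ℕ+) : Ser 𝕜 :=
  MvPowerSeries.X (some k) + c k • MvPowerSeries.X none ^ (k : ℕ)

theorem coeff_shiftTau (c : ℕ+ → 𝕜) (τ : MvPowerSeries ℕ+ 𝕜) (e : Var →₀ ℕ) :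
    MvPowerSeries.coeff e (shiftTau c τ) = ∑ᶠ d : ℕ+ →₀ ℕ,
      MvPowerSeries.coeff d τ * MvPowerSeries.coeff e (d.prod fun k n => shiftVar c k ^ n) :=
  MvPowerSeries.coeff_subst (hasSubst_shift c) τ e

theorem coeff_shiftTau_support_finite (c : ℕ+ → 𝕜) (τ : MvPowerSeries ℕ+ 𝕜) (e : Var →₀ ℕ) :
    (Function.support fun d : ℕ+ →₀ ℕ => MvPowerSeries.coeff d τ *
      MvPowerSeries.coeff e (d.prod fun k n => shiftVar c k ^ n)).Finite :=
  MvPowerSeries.coeff_subst_finite (hasSubst_shift c) τ e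

/-- The grading in which `x` has weight `1` and `t_k` has weight `k`. -/
def varWeight : Var → ℕ := fun v => v.elim 1 fun k => (k : ℕ)

/-- Whatever `c` is, `t_k + c_k x^k` is homogeneous of weight `k`, so a product of such factors has
monomials of one weight only. The factors are polynomials, and the argument takes place in the
polynomial ring before passing to power series. -/
theorem coeff_prod_shiftVar_eq_zero (c : ℕ+ → 𝕜) (d : ℕ+ →₀ ℕ) (e : Var →₀ ℕ)
    (h : Finsupp.weight varWeight e ≠ d.sum fun k n => n * (k : ℕ)) :
    MvPowerSeries.coeff e (d.prod fun k n => shiftVar c k ^ n) = 0 := by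
  let P : ℕ+ → MvPolynomial Var 𝕜 := fun k =>
    MvPolynomial.X (some k) + MvPolynomial.C (c k) * MvPolynomial.X none ^ (k : ℕ)
  have hP : ∀ k, ((P k : MvPolynomial Var 𝕜) : Ser 𝕜) = shiftVar c k := by
    intro k
    simp [P, shiftVar, MvPowerSeries.smul_eq_C_mul]
  have hw : ∀ k, MvPolynomial.IsWeightedHomogeneous varWeight (P k) (k : ℕ) := by
    intro k
    refine MvPolynomial.IsWeightedHomogeneous.add
      (MvPolynomial.isWeightedHomogeneous_X 𝕜 varWeight (some k)) ?_
    have h1 := (MvPolynomial.isWeightedHomogeneous_C varWeight (c k)).mul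
      ((MvPolynomial.isWeightedHomogeneous_X 𝕜 varWeight none).pow (k : ℕ))
    simpa [varWeight] using h1
  have hprod : MvPolynomial.IsWeightedHomogeneous varWeight (d.prod fun k n => P k ^ n)
      (d.sum fun k n => n * (k : ℕ)) := by
    refine MvPolynomial.IsWeightedHomogeneous.prod d.support _ _ fun k _ => ?_
    simpa using (hw k).pow (d k)
  have hcoe : ((d.prod fun k n => P k ^ n : MvPolynomial Var 𝕜) : Ser 𝕜) =
      d.prod fun k n => shiftVar c k ^ n := by
    rw [← MvPolynomial.coeToMvPowerSeries.ringHom_apply, map_finsuppProd]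
    simp [hP]
  rw [← hcoe, MvPolynomial.coeff_coe]
  exact hprod.coeff_eq_zero e h

/-- These are the partitions of `N`: parts and multiplicities are at most `N`, so all of them lie
below one finitely supported function. -/
theorem finite_sum_mul_eq (N : ℕ) :
    {d : ℕ+ →₀ ℕ | (d.sum fun k n => n * (k : ℕ)) = N}.Finite := by
  classical
  let b : ℕ+ →₀ ℕ := Finsupp.indicator
    ((Set.finite_le_nat N).preimage (f := fun k : ℕ+ => (k : ℕ)) PNat.coe_injective.injOn).toFinset
    fun _ _ => N
  refine (Set.finite_Iic b).subset fun d hd k => ?_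
  by_cases hk : d k = 0
  · simp [hk]
  have h1 : d k * (k : ℕ) ≤ N := by
    rw [← show (d.sum fun k n => n * (k : ℕ)) = N from hd]
    exact Finset.single_le_sum (f := fun k => d k * (k : ℕ)) (fun _ _ => Nat.zero_le _)
      (Finsupp.mem_support_iff.2 hk)
  have h2 : (k : ℕ) ≤ N := (Nat.le_mul_of_pos_left _ (Nat.pos_of_ne_zero hk)).trans h1
  have h3 : d k ≤ N := (Nat.le_mul_of_pos_right _ k.pos).trans h1
  have hb : b k = N := by
    simp [b, h2]
  rw [hb]
  exact h3

/-- A coefficient of `τ(t₁ + c₁ x, …)` as a sum over a finite set which does not depend on `c`. -/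
theorem coeff_shiftTau_eq_sum (c : ℕ+ → 𝕜) (τ : MvPowerSeries ℕ+ 𝕜) (e : Var →₀ ℕ) :
    MvPowerSeries.coeff e (shiftTau c τ) =
      ∑ d ∈ (finite_sum_mul_eq (Finsupp.weight varWeight e)).toFinset,
        MvPowerSeries.coeff d τ *
          MvPowerSeries.coeff e (d.prod fun k n => shiftVar c k ^ n) := by
  rw [coeff_shiftTau]
  refine finsum_eq_sum_of_support_subset _ fun d hd => ?_
  rw [Set.Finite.coe_toFinset]
  by_contra hne
  refine hd ?_
  dsimp only
  rw [coeff_prod_shiftVar_eq_zero c d e (fun h => hne h.symm), mul_zero]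

/-- `∂_x τ(t₁ + x, t₂, …) = ∂₁ τ(t₁ + x, t₂, …)`. -/
theorem pderiv_none_tauOne (τ : MvPowerSeries ℕ+ 𝕜) :
    MvPowerSeries.pderiv 𝕜 none (tauOne τ) = dt 1 (tauOne τ) := by
  let c : ℕ+ → 𝕜 := fun k => if k = 1 then 1 else 0
  -- Termwise differentiation is legitimate because each coefficient of a derivative is a scalar
  -- times one coefficient of the series, which is a sum with finite support.
  have hpd : ∀ (v : Var) (e : Var →₀ ℕ),
      MvPowerSeries.coeff e (MvPowerSeries.pderiv 𝕜 v (shiftTau c τ)) =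
      ∑ᶠ d : ℕ+ →₀ ℕ, MvPowerSeries.coeff d τ * MvPowerSeries.coeff e
        (MvPowerSeries.pderiv 𝕜 v (d.prod fun k n => shiftVar c k ^ n)) := by
    intro v e
    rw [MvPowerSeries.coeff_pderiv, coeff_shiftTau,
      finsum_mul' _ _ (coeff_shiftTau_support_finite c τ _)]
    exact finsum_congr fun d => by rw [MvPowerSeries.coeff_pderiv, mul_assoc]
  -- Both derivatives of `t_k + c_k x^k` are `1` for `k = 1` and `0` otherwise. The Leibniz rule
  -- carries the equality to products.
  have hfac : ∀ k, MvPowerSeries.pderiv 𝕜 none (shiftVar c k) =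
      MvPowerSeries.pderiv 𝕜 (some 1) (shiftVar c k) := by
    intro k
    by_cases hk : k = 1
    · subst hk
      simp [shiftVar, c]
    · simp [shiftVar, c, hk]
  have hpr : ∀ d : ℕ+ →₀ ℕ,
      MvPowerSeries.pderiv 𝕜 none (d.prod fun k n => shiftVar c k ^ n) =
      MvPowerSeries.pderiv 𝕜 (some 1) (d.prod fun k n => shiftVar c k ^ n) := by
    intro d
    rw [Finsupp.prod]
    induction d.support using Finset.cons_induction with
    | empty => simp
    | cons k s hk ih =>
      rw [Finset.prod_cons, Derivation.leibniz, Derivation.leibniz, ih, Derivation.leibniz_pow,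
        Derivation.leibniz_pow, hfac]
  ext e
  change MvPowerSeries.coeff e (MvPowerSeries.pderiv 𝕜 none (shiftTau c τ)) =
    MvPowerSeries.coeff e (MvPowerSeries.pderiv 𝕜 (some 1) (shiftTau c τ))
  rw [hpd, hpd]
  exact finsum_congr fun d => by rw [hpr]

theorem pderiv_none_dt (k : ℕ+) (f : Ser 𝕜) :
    MvPowerSeries.pderiv 𝕜 none (dt k f) = dt k (MvPowerSeries.pderiv 𝕜 none f) := by
  change MvPowerSeries.pderiv 𝕜 none (MvPowerSeries.pderiv 𝕜 (some k) f) =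
    MvPowerSeries.pderiv 𝕜 (some k) (MvPowerSeries.pderiv 𝕜 none f)
  ext e
  simp only [MvPowerSeries.coeff_pderiv]
  rw [add_right_comm]
  simp
  ring

end Shift

/-! ### Coefficientwise limits of power series -/

section Limits

variable [TopologicalSpace 𝕜] {ι : Type*} {l : Filter ι}

theorem SerTendsto.const (f : Ser 𝕜) : SerTendsto l (fun _ => f) f := fun _ => tendsto_const_nhds

variable [IsTopologicalRing 𝕜]

theorem SerTendsto.add {f g : ι → Ser 𝕜} {f₀ g₀ : Ser 𝕜} (hf : SerTendsto l f f₀)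
    (hg : SerTendsto l g g₀) : SerTendsto l (fun i => f i + g i) (f₀ + g₀) := fun d => by
  simpa only [map_add] using (hf d).add (hg d)

theorem SerTendsto.sub {f g : ι → Ser 𝕜} {f₀ g₀ : Ser 𝕜} (hf : SerTendsto l f f₀)
    (hg : SerTendsto l g g₀) : SerTendsto l (fun i => f i - g i) (f₀ - g₀) := fun d => by
  simpa only [map_sub] using (hf d).sub (hg d)

theorem SerTendsto.mul {f g : ι → Ser 𝕜} {f₀ g₀ : Ser 𝕜} (hf : SerTendsto l f f₀)
    (hg : SerTendsto l g g₀) : SerTendsto l (fun i => f i * g i) (f₀ * g₀) := fun d => by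
  classical
  simp only [MvPowerSeries.coeff_mul]
  exact tendsto_finsetSum _ fun p _ => (hf p.1).mul (hg p.2)

theorem SerTendsto.smul {a : ι → 𝕜} {a₀ : 𝕜} {f : ι → Ser 𝕜} {f₀ : Ser 𝕜}
    (ha : Tendsto a l (𝓝 a₀)) (hf : SerTendsto l f f₀) :
    SerTendsto l (fun i => a i • f i) (a₀ • f₀) := fun d => by
  simpa only [map_smul, smul_eq_mul] using ha.mul (hf d)

theorem SerTendsto.pow {f : ι → Ser 𝕜} {f₀ : Ser 𝕜} (hf : SerTendsto l f f₀) (n : ℕ) :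
    SerTendsto l (fun i => f i ^ n) (f₀ ^ n) := by
  induction n with
  | zero => simpa only [pow_zero] using SerTendsto.const 1
  | succ n ih => simpa only [pow_succ] using ih.mul hf

theorem SerTendsto.finset_prod {κ : Type*} (s : Finset κ) {f : κ → ι → Ser 𝕜} {f₀ : κ → Ser 𝕜}
    (hf : ∀ k, SerTendsto l (f k) (f₀ k)) :
    SerTendsto l (fun i => ∏ k ∈ s, f k i) (∏ k ∈ s, f₀ k) := by
  induction s using Finset.cons_induction with
  | empty => simpa only [Finset.prod_empty] using SerTendsto.const 1
  | cons k s hk ih => simpa only [Finset.prod_cons] using (hf k).mul ih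

theorem SerTendsto.dt {f : ι → Ser 𝕜} {f₀ : Ser 𝕜} (hf : SerTendsto l f f₀) (k : ℕ+) :
    SerTendsto l (fun i => QKP.dt k (f i)) (QKP.dt k f₀) := fun d => by
  change Tendsto (fun i => MvPowerSeries.coeff d (MvPowerSeries.pderiv 𝕜 (some k) (f i))) l
    (𝓝 (MvPowerSeries.coeff d (MvPowerSeries.pderiv 𝕜 (some k) f₀)))
  simp only [MvPowerSeries.coeff_pderiv]
  exact (hf _).mul_const _

/-- Each coefficient is a sum over a finite set independent of `c`, and each summand depends on `c`
only through finitely many products and powers of the factors. Convergence of every `c_k` separately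
is therefore enough. -/
theorem SerTendsto.shiftTau {c : ι → ℕ+ → 𝕜} {c₀ : ℕ+ → 𝕜}
    (hc : ∀ k, Tendsto (fun i => c i k) l (𝓝 (c₀ k))) (τ : MvPowerSeries ℕ+ 𝕜) :
    SerTendsto l (fun i => QKP.shiftTau (c i) τ) (QKP.shiftTau c₀ τ) := fun e => by
  simp only [coeff_shiftTau_eq_sum]
  refine tendsto_finsetSum _ fun d _ => Tendsto.const_mul _ ?_
  refine SerTendsto.finset_prod d.support (fun k => SerTendsto.pow ?_ (d k)) e
  exact (SerTendsto.const _).add (SerTendsto.smul (hc k) (SerTendsto.const _))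

end Limits

/-! ### The `q`-derivative on power series, and `u` as a quotient without the factor `(q-1)x` -/

section QDerivative

/-- The `q`-derivative `(f(qx,t) - f(x,t)) / ((q-1)x)` of a power series. -/
def qDerivSer (q : QParam 𝕜) (f : Ser 𝕜) : Ser 𝕜 := fun d =>
  qNum q (d none + 1) * MvPowerSeries.coeff (d + Finsupp.single none 1) f

theorem coeff_qDerivSer (q : QParam 𝕜) (f : Ser 𝕜) (d : Var →₀ ℕ) :
    MvPowerSeries.coeff d (qDerivSer q f) =
      qNum q (d none + 1) * MvPowerSeries.coeff (d + Finsupp.single none 1) f := rfl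

theorem coeff_rescale_scaleVec (a : 𝕜) (f : Ser 𝕜) (d : Var →₀ ℕ) :
    MvPowerSeries.coeff d (MvPowerSeries.rescale (scaleVec a) f) =
      a ^ d none * MvPowerSeries.coeff d f := by
  rw [MvPowerSeries.coeff_rescale]
  congr 1
  rw [Finsupp.prod_eq_single none]
  · rfl
  · rintro (_ | k) _ h
    · exact absurd rfl h
    · simp [scaleVec]
  · simp

/-- On the power `x^n` this is `q^n = 1 + (q-1)[n]_q`. It shows that dividing `f(qx,t) - f(x,t)` by
`(q-1)x` stays within power series. -/
theorem rescale_scaleVec_eq (q : QParam 𝕜) (f : Ser 𝕜) :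
    MvPowerSeries.rescale (scaleVec q.val) f =
      f + (q.val - 1) • (MvPowerSeries.X none * qDerivSer q f) := by
  classical
  ext d
  rw [coeff_rescale_scaleVec, map_add, map_smul, MvPowerSeries.X, MvPowerSeries.coeff_monomial_mul,
    smul_eq_mul]
  by_cases hd : d none = 0
  · rw [if_neg (by rw [Finsupp.single_le_iff]; omega), hd]
    simp
  · have hle : Finsupp.single none 1 ≤ d := by rw [Finsupp.single_le_iff]; omega
    rw [if_pos hle, coeff_qDerivSer, tsub_add_cancel_of_le hle, qNum]
    have h1 : (((d - Finsupp.single none 1 : Var →₀ ℕ) none : ℕ) : ℤ) + 1 = (d none : ℕ) := by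
      rw [Finsupp.tsub_apply, Finsupp.single_eq_same]
      omega
    rw [h1, zpow_natCast]
    have := q_ne_one q
    field_simp
    ring

theorem D_toFun_eq (q : QParam 𝕜) (f : Ser 𝕜) :
    D q (toFun f) = toFun f + (algebraMap 𝕜 (Fun 𝕜) (q.val - 1) * xvar) *
      toFun (qDerivSer q f) := by
  rw [D_toFun, rescale_scaleVec_eq, toFun, map_add, Algebra.smul_def, map_mul, map_mul,
    ← IsScalarTower.algebraMap_apply, xvar, mul_assoc]

theorem toFun_ne_zero {f : Ser 𝕜} (hf : f ≠ 0) : toFun f ≠ 0 := fun h =>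
  hf (IsFractionRing.injective (Ser 𝕜) (Fun 𝕜) (by rw [map_zero]; exact h))

theorem qxvar_ne_zero (q : QParam 𝕜) :
    algebraMap 𝕜 (Fun 𝕜) (q.val - 1) * xvar ≠ 0 :=
  mul_ne_zero ((map_ne_zero _).2 (q_ne_one q)) xvar_ne_zero

/-- The coefficient of `D_q⁻¹` in the Lax operator as a quotient of power series. -/
theorem coordinate_eq_div (q : QParam 𝕜) {f : Ser 𝕜} (hf : f ≠ 0) (g h : Ser 𝕜) :
    let R := MvPowerSeries.rescale (scaleVec q.val)
    toFun h / toFun f - D q (toFun h / toFun f) - (toFun g / toFun f) ^ 2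
        + toFun g / toFun f * D q (toFun g / toFun f) + Dq q (toFun g / toFun f) =
      toFun (h * f * R f - f ^ 2 * R h - g ^ 2 * R f + g * R g * f
        + f * (qDerivSer q g * f - g * qDerivSer q f)) / toFun (f ^ 2 * R f) := by
  intro R
  have hf' := toFun_ne_zero hf
  have hD : D q (toFun f) ≠ 0 := (map_ne_zero _).2 hf'
  have hx := qxvar_ne_zero q
  have e : ∀ p : Ser 𝕜, algebraMap (Ser 𝕜) (Fun 𝕜) (R p) = D q (toFun p) :=
    fun p => (D_toFun q p).symm
  -- The quotient rule for `D_q`: expanding `D g` and `D f` by `D_toFun_eq` cancels the factor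
  -- `(q-1)x`, which would otherwise tend to `0` in the denominator.
  have hq : Dq q (toFun g / toFun f) =
      (toFun (qDerivSer q g) * toFun f - toFun g * toFun (qDerivSer q f)) /
        (toFun f * D q (toFun f)) := by
    rw [Dq, map_div₀, Algebra.smul_def, div_sub_div _ _ hD hf', div_div,
      div_eq_div_iff (mul_ne_zero (mul_ne_zero hD hf') hx) (mul_ne_zero hf' hD)]
    rw [D_toFun_eq q g, D_toFun_eq q f]
    ring
  rw [hq]
  simp only [map_div₀, toFun, map_mul, map_sub, map_add, map_pow, e]
  field_simp

theorem qNum_eq_geom_sum (q : QParam 𝕜) (n : ℕ) :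
    (q.val ^ n - 1) / (q.val - 1) = ∑ i ∈ Finset.range n, q.val ^ i := by
  rw [div_eq_iff (q_ne_one q), geom_sum_mul]

end QDerivative

/-! ### The limit `q → 1` of scaling, `q`-derivative and `τ_q` -/

section QToOne

variable [TopologicalSpace 𝕜]

theorem tendsto_val : Tendsto QParam.val (qToOne 𝕜) (𝓝 1) := tendsto_comap

variable [IsTopologicalRing 𝕜]

theorem tendsto_geom_sum (n : ℕ) :
    Tendsto (fun q : QParam 𝕜 => ∑ i ∈ Finset.range n, q.val ^ i) (qToOne 𝕜) (𝓝 (n : 𝕜)) := by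
  have h := tendsto_finsetSum (Finset.range n) fun i _ => (tendsto_val (𝕜 := 𝕜)).pow i
  simpa using h

theorem SerTendsto.rescale {f : QParam 𝕜 → Ser 𝕜} {f₀ : Ser 𝕜}
    (hf : SerTendsto (qToOne 𝕜) f f₀) :
    SerTendsto (qToOne 𝕜) (fun q => MvPowerSeries.rescale (scaleVec q.val) (f q)) f₀ :=
  fun d => by
    simp only [coeff_rescale_scaleVec]
    simpa using ((tendsto_val (𝕜 := 𝕜)).pow (d none)).mul (hf d)

/-- Written as the geometric sum `1 + q + ⋯ + q^(n-1)`, `[n]_q` has no singularity at `q = 1` and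
tends to `n`, the factor produced by `∂_x`. -/
theorem SerTendsto.qDerivSer {f : QParam 𝕜 → Ser 𝕜} {f₀ : Ser 𝕜}
    (hf : SerTendsto (qToOne 𝕜) f f₀) :
    SerTendsto (qToOne 𝕜) (fun q => QKP.qDerivSer q (f q)) (MvPowerSeries.pderiv 𝕜 none f₀) :=
  fun d => by
    have h := (tendsto_geom_sum (𝕜 := 𝕜) (d none + 1)).mul (hf (d + Finsupp.single none 1))
    have e : ∀ q : QParam 𝕜, ∑ i ∈ Finset.range (d none + 1), q.val ^ i =
        qNum q (d none + 1) := by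
      intro q
      rw [← qNum_eq_geom_sum, qNum]
      norm_cast
    simp only [e] at h
    simp only [coeff_qDerivSer, MvPowerSeries.coeff_pderiv]
    rw [mul_comm]
    exact_mod_cast h

theorem tendsto_tauQ [ContinuousInv₀ 𝕜] [CharZero 𝕜] (τ : MvPowerSeries ℕ+ 𝕜) :
    SerTendsto (qToOne 𝕜) (fun q => tauQ q τ) (tauOne τ) := by
  refine SerTendsto.shiftTau (fun k => ?_) τ
  have hk : ((k : ℕ) : 𝕜) ≠ 0 := Nat.cast_ne_zero.2 k.ne_zero
  -- Cancelling one factor `1 - q` removes the indeterminate form `0/0`.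
  have e : ∀ q : QParam 𝕜, (1 - q.val) ^ (k : ℕ) / ((k : ℕ) * (1 - q.val ^ (k : ℕ))) =
      (1 - q.val) ^ ((k : ℕ) - 1) / ((k : ℕ) * ∑ i ∈ Finset.range (k : ℕ), q.val ^ i) := by
    intro q
    have h1 : 1 - q.val ≠ 0 := by
      rw [← neg_sub]; exact neg_ne_zero.2 (q_ne_one q)
    rw [← mul_neg_geom_sum, mul_left_comm]
    rw [← mul_pow_sub_one k.ne_zero (1 - q.val), mul_div_mul_left _ _ h1]
  simp only [e]
  -- The denominator tends to `k · k`, nonzero in characteristic zero. The numerator tends to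
  -- `0^(k-1)`, which is `1` exactly when `k = 1`.
  have h := (((tendsto_const_nhds (x := (1 : 𝕜))).sub (tendsto_val (𝕜 := 𝕜))).pow
    ((k : ℕ) - 1)).div ((tendsto_geom_sum (𝕜 := 𝕜) (k : ℕ)).const_mul ((k : ℕ) : 𝕜))
    (mul_ne_zero hk hk)
  convert h using 1
  congr 1
  by_cases h1 : k = 1
  · simp [h1]
  · have h2 : (k : ℕ) - 1 ≠ 0 := by
      have := k.pos
      have : (k : ℕ) ≠ 1 := fun hc => h1 (PNat.coe_injective hc)
      omega
    simp [h1, h2]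

end QToOne

/-! ### The coefficient `u` of the Lax operator and its limit -/

section Dressing

theorem dressing_isMonicZero (q : QParam 𝕜) {τ : MvPowerSeries ℕ+ 𝕜} (hτ : τ ≠ 0) :
    (dressing q τ).IsMonicZero := by
  refine ⟨fun n hn => if_neg (by omega), ?_⟩
  have h : tauQ q τ ≠ 0 := shiftTau_ne_zero _ hτ
  simp [dressing, schurOp_zero, toFun_ne_zero h]

theorem dressing_coeff_neg_one (q : QParam 𝕜) (τ : MvPowerSeries ℕ+ 𝕜) :
    (dressing q τ).coeff (-1) = -(toFun (dt 1 (tauQ q τ)) / toFun (tauQ q τ)) := by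
  simp [dressing, schurOp_one_negDtTilde, neg_div]

theorem dressing_coeff_neg_two (q : QParam 𝕜) (τ : MvPowerSeries ℕ+ 𝕜) :
    (dressing q τ).coeff (-2) =
      toFun (schurOp 2 negDtTilde (tauQ q τ)) / toFun (tauQ q τ) := by
  simp [dressing]

theorem Dq_neg (q : QParam 𝕜) (f : Fun 𝕜) : Dq q (-f) = -Dq q f := by
  simpa using Dq_smul q (-1) f

theorem smul_xvar_mul_Dq (q : QParam 𝕜) (f : Fun 𝕜) :
    (q.val - 1) • (xvar * Dq q f) = D q f - f := by
  have hx := qxvar_ne_zero q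
  rw [← smul_mul_assoc, Dq, Algebra.smul_def, mul_div_cancel₀ _ hx]

/-- This is `PDO.coeff_conj` at `s₁ = -g/f` and `s₂ = h/f`. The sign of `s₁` turns `-D_q s₁` into
`+D_q(g/f)`. -/
theorem lax_coeff_neg_one (q : QParam 𝕜) {τ : MvPowerSeries ℕ+ 𝕜} (hτ : τ ≠ 0) :
    let f := tauQ q τ
    let g := dt 1 f
    let h := (1 / 2 : 𝕜) • (dt 1 (dt 1 f) - dt 2 f)
    (lax q τ).coeff (-1) = (toFun h / toFun f - D q (toFun h / toFun f))
      - (toFun g / toFun f) ^ 2 + toFun g / toFun f * D q (toFun g / toFun f)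
      + Dq q (toFun g / toFun f) := by
  intro f g h
  rw [lax, (PDO.coeff_conj (dressing_isMonicZero q hτ)).2, dressing_coeff_neg_one,
    dressing_coeff_neg_two, schurOp_two_negDtTilde, Dq_neg, map_neg]
  ring

theorem funTendsto_lax [TopologicalSpace 𝕜] [IsTopologicalRing 𝕜] [ContinuousInv₀ 𝕜] [CharZero 𝕜]
    {τ : MvPowerSeries ℕ+ 𝕜} (hτ : τ ≠ 0) :
    FunTendsto (qToOne 𝕜) (fun q : QParam 𝕜 => (lax q τ).coeff (-1))
      (dtFun 1 (toFun (dt 1 (tauOne τ)) / toFun (tauOne τ))) := by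
  have h1 : tauOne τ ≠ 0 := shiftTau_ne_zero _ hτ
  have hf := tendsto_tauQ τ
  have hg := hf.dt 1
  have hh := SerTendsto.smul (tendsto_const_nhds (x := (1 / 2 : 𝕜))) ((hg.dt 1).sub (hf.dt 2))
  have hR : ∀ q : QParam 𝕜, MvPowerSeries.rescale (scaleVec q.val) (tauQ q τ) ≠ 0 := by
    intro q hc
    have hq : toFun (tauQ q τ) ≠ 0 := toFun_ne_zero (shiftTau_ne_zero _ hτ)
    refine (map_ne_zero (D q)).2 hq ?_
    rw [D_toFun, hc, toFun, map_zero]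
  -- The four series are read off from the convergence proofs, which are assembled in the same shape
  -- as the quotient in `coordinate_eq_div`.
  refine ⟨_, _, _, _, ?_, ((((hh.mul hf).mul hf.rescale).sub ((hf.pow 2).mul hh.rescale)).sub
    ((hg.pow 2).mul hf.rescale)).add ((hg.mul hg.rescale).mul hf) |>.add
    (hf.mul ((hg.qDerivSer.mul hf).sub (hg.mul hf.qDerivSer))), (hf.pow 2).mul hf.rescale,
    Eventually.of_forall fun q => ⟨?_, ?_⟩, ?_⟩
  · exact mul_ne_zero (pow_ne_zero 2 h1) h1
  · exact mul_ne_zero (pow_ne_zero 2 (shiftTau_ne_zero _ hτ)) (hR q)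
  · refine (lax_coeff_neg_one q hτ).trans ?_
    exact coordinate_eq_div q (shiftTau_ne_zero _ hτ) _ _
  -- In the limit numerator, `h f f` cancels `f² h` and `g² f` cancels `g g f`. What remains is `f
  -- (f ∂_x g - g ∂_x f)` over `f³`, the quotient rule for `g/f` once `∂_x` is replaced by `∂₁`.
  · rw [dtFun_div _ _ _ h1, pderiv_none_dt, pderiv_none_tauOne]
    have h1' := toFun_ne_zero h1
    rw [div_eq_div_iff (pow_ne_zero 2 h1')
      (toFun_ne_zero (mul_ne_zero (pow_ne_zero 2 h1) h1))]
    simp only [toFun, ← map_mul, ← map_pow]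
    congr 1
    ring

end Dressing

end QKP

end

theorem mainTheorem2 {𝕜 : Type*} [RCLike 𝕜] (τ : MvPowerSeries ℕ+ 𝕜) (hτ : τ ≠ 0) :
    (∀ q : QKP.QParam 𝕜,
      let τq : QKP.Ser 𝕜 := QKP.tauQ q τ
      -- `v = ∂₁τ_q / τ_q`, `w = (1/2)(∂₁² - ∂₂)τ_q / τ_q`, `w' = p₂(-∂̃)τ_q / τ_q`
      let v : QKP.Fun 𝕜 := QKP.toFun (QKP.dt 1 τq) / QKP.toFun τq
      let w : QKP.Fun 𝕜 :=
        QKP.toFun ((1 / 2 : 𝕜) • (QKP.dt 1 (QKP.dt 1 τq) - QKP.dt 2 τq)) / QKP.toFun τq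
      let w' : QKP.Fun 𝕜 := QKP.toFun (QKP.schurOp 2 QKP.negDtTilde τq) / QKP.toFun τq
      let L : QKP.PDO q := QKP.lax q τ
      let u : QKP.Fun 𝕜 := L.coeff (-1)
      -- `S` is invertible and `L = S D_q S⁻¹` has the form `D_q + a₀ + a₁ D_q⁻¹ + ⋯`
      τq ≠ 0 ∧ IsUnit (QKP.dressing q τ) ∧
      (∀ n : ℤ, 1 < n → L.coeff n = 0) ∧ L.coeff 1 = 1 ∧
      -- `u = (1 - D) w - v² + v D(v) + D_q v`
      u = (w - QKP.D q w) - v ^ 2 + v * QKP.D q v + QKP.Dq q v ∧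
      -- `u = -(q - 1) x D_q w' + v (q - 1) x D_q v + D_q v`
      u = -((q.val - 1) • (QKP.xvar * QKP.Dq q w'))
          + v * ((q.val - 1) • (QKP.xvar * QKP.Dq q v)) + QKP.Dq q v) ∧
    -- as `q → 1`, `u → ∂₁(∂₁τ / τ)` evaluated at `(t₁ + x, t₂, t₃, …)`
    QKP.FunTendsto (QKP.qToOne 𝕜) (fun q : QKP.QParam 𝕜 => (QKP.lax q τ).coeff (-1))
      (QKP.dtFun 1 (QKP.toFun (QKP.dt 1 (QKP.tauOne τ)) / QKP.toFun (QKP.tauOne τ))) := by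
  refine ⟨fun q => ?_, QKP.funTendsto_lax hτ⟩
  intro τq v w w' L u
  have hS := QKP.dressing_isMonicZero q hτ
  have hu := QKP.lax_coeff_neg_one q hτ
  refine ⟨QKP.shiftTau_ne_zero _ hτ, hS.isUnit, QKP.PDO.conj_le hS,
    (QKP.PDO.coeff_conj hS).1, hu, ?_⟩
  have hw : w' = w := by
    simp only [w', w, QKP.schurOp_two_negDtTilde]
  -- Replacing each `(q-1) x D_q` by `D - 1` turns the second formula into the first.
  rw [QKP.smul_xvar_mul_Dq, QKP.smul_xvar_mul_Dq, hw]
  refine hu.trans ?_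
  ring
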